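/- Let $D$ be a finite set with at least two elements. A $k$-ary operation on $D$ ($k\ge 1$) is a map $f:D^k\to D$; the $k$-ary projections are $e^{(k)}_i(x_1,\dots,x_k)=x_i$. The superposition of a $k$-ary $f$ with $\ell$-ary $g_1,\dots,g_k$ is the $\ell$-ary operation $f[g_1,\dots,g_k](x)=f(g_1(x),\dots,g_k(x))$. A clone $C$ on $D$ is a set of operations that contains all projections and is closed under superposition; $C^{(k)}$ denotes its set of $k$-ary operations. A $k$-ary weighting of $C$ is a function $\omega:C^{(k)}\to\mathbb{Q}$ with $\sum_{f\in C^{(k)}}\omega(f)=0$ such that $\omega(f)<0$ only if $f$ is a projection; $\mathrm{supp}(\omega)=\{f\in C^{(k)}:\omega(f)>0\}$, and $\omega$ is positive if $\mathrm{supp}(\omega)$ contains an operation that is not a projection. For $g_1,\dots,g_k\in C^{(\ell)}$ put $\omega[g_1,\dots,g_k](f')=\sum_{f\in C^{(k)},\,f[g_1,\dots,g_k]=f'}\omega(f)$ for $f'\in C^{(\ell)}$; this superposition is proper if it is again a weighting. A weighted clone $W$ with support clone $C$ is a nonempty set of weightings of $C$ closed under scaling by nonnegative rationals, addition of weightings of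 equal arity, and proper superposition with operations from $C$. It is a rigid core if the only unary operation in $C$ is $e^{(1)}_1$ (equivalently, all operations in $C$ are idempotent). A $k$-ary operation $f$ is idempotent if $f(x,\dots,x)=x$ for all $x\in D$. A ternary operation $f$ is a majority operation if $f(x,x,y)=f(x,y,x)=f(y,x,x)=x$ for all $x,y\in D$, and a minority operation if $f(x,x,y)=f(x,y,x)=f(y,x,x)=y$ for all $x,y\in D$. For $k\ge 3$, a $k$-ary operation $f$ is a semiprojection if it is not a projection and there is an index $i$ such that $f(x_1,\dots,x_k)=x_i$ whenever $x_1,\dots,x_k$ are not pairwise distinct. **Theorem.** Let $W$ be a weighted clone on $D$ that is a rigid core and contains a positive weighting. Then $W$ contains a weighting $\omega$ with nonempty support such that one of the following holds: 1. $\omega$ is binary and $\mathrm{supp}(\omega)$ consists of idempotent operations that are not projections; 2. $\omega$ is ternary and (a) $\mathrm{supp}(\omega)$ consists of majority operations, or (b) $\mathrm{supp}(\omega)$ consists of minority operations, or (c) $\mathrm{supp}(\omega)$ consists of majority operations, of total weight $2$ under $\omega$, and minority operations, of total weight $1$ under $\omega$; 3. $\omega$ is $k$-ary for some $k\ge 3$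 and $\mathrm{supp}(\omega)$ consists of semiprojections. -/

import Mathlib

/-- `k`-ary operations on `D`. -/
abbrev Operation (D : Type*) (k : ℕ) : Type _ := (Fin k → D) → D

namespace Operation

variable {D : Type*} {k l : ℕ}

/-- The `k`-ary projection to the `i`-th coordinate. -/
def proj (D : Type*) {k : ℕ} (i : Fin k) : Operation D k := fun x => x i

def IsProjection (f : Operation D k) : Prop := ∃ i : Fin k, f = proj D i

/-- The superposition `f[g₁, …, g_k]`. -/
def superpose (f : Operation D k) (g : Fin k → Operation D l) : Operation D l :=
  fun x => f (fun i => g i x)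

def IsIdempotent (f : Operation D k) : Prop := ∀ x : D, f (fun _ => x) = x

def IsMajority (f : Operation D 3) : Prop :=
  ∀ x y : D, f ![x, x, y] = x ∧ f ![x, y, x] = x ∧ f ![y, x, x] = x

def IsMinority (f : Operation D 3) : Prop :=
  ∀ x y : D, f ![x, x, y] = y ∧ f ![x, y, x] = y ∧ f ![y, x, x] = y

/-- A semiprojection: an operation of arity at least three, not a projection, which agrees with
one fixed projection on all tuples whose entries are not pairwise distinct. -/
def IsSemiprojection (f : Operation D k) : Prop :=
  3 ≤ k ∧ ¬ f.IsProjection ∧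
    ∃ i : Fin k, ∀ x : Fin k → D, ¬ Function.Injective x → f x = x i

end Operation

/-- A clone of operations on `D`: a set of operations of positive arities that contains all
projections and is closed under superposition. `ops k` is its set of `k`-ary operations. -/
structure OperationClone (D : Type*) where
  ops : (k : ℕ) → Set (Operation D k)
  ops_zero : ops 0 = ∅
  proj_mem : ∀ (k : ℕ) (i : Fin k), Operation.proj D i ∈ ops k
  superpose_mem : ∀ (k l : ℕ) (f : Operation D k) (g : Fin k → Operation D l),
    f ∈ ops k → (∀ i, g i ∈ ops l) → f.superpose g ∈ ops l

namespace OperationClone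

variable {D : Type*}

/-- The type of `k`-ary operations in the clone `C`. -/
abbrev Op (C : OperationClone D) (k : ℕ) : Type _ := {f : Operation D k // f ∈ C.ops k}

noncomputable instance [Finite D] (C : OperationClone D) (k : ℕ) : Fintype (C.Op k) :=
  Fintype.ofFinite _

/-- A `k`-ary weighting of the clone `C`. -/
def IsWeighting [Finite D] {C : OperationClone D} {k : ℕ} (ω : C.Op k → ℚ) : Prop :=
  (∀ f, ω f < 0 → f.1.IsProjection) ∧ ∑ f, ω f = 0

/-- The support of a weighting: the operations of positive weight. -/
def supp {C : OperationClone D} {k : ℕ} (ω : C.Op k → ℚ) : Set (C.Op k) := {f | 0 < ω f}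

/-- A positive weighting assigns positive weight to some operation that is not a projection. -/
def IsPositive {C : OperationClone D} {k : ℕ} (ω : C.Op k → ℚ) : Prop :=
  ∃ f ∈ supp ω, ¬ f.1.IsProjection

open Classical in
/-- The superposition `ω[g₁, …, g_k]` of a weight function with operations of the clone. -/
noncomputable def superposeWeighting [Finite D] {C : OperationClone D} {k l : ℕ}
    (ω : C.Op k → ℚ) (g : Fin k → C.Op l) : C.Op l → ℚ :=
  fun f' => ∑ f : C.Op k with f.1.superpose (fun i => (g i).1) = f'.1, ω f

open Classical in
/-- The total weight of those operations in the support of `ω` that satisfy `P`. -/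
noncomputable def suppWeight [Finite D] {C : OperationClone D} {k : ℕ}
    (ω : C.Op k → ℚ) (P : Operation D k → Prop) : ℚ :=
  ∑ f : C.Op k with f ∈ supp ω ∧ P f.1, ω f

end OperationClone

/-- A weighted clone on the finite set `D`: a nonempty set of weightings (of positive arities) of a
fixed clone, its support clone, closed under nonnegative scaling, addition of weightings of equal
arity, and proper superposition (one whose result is again a weighting) with operations from the
support clone. `weightings k` is its set of `k`-ary weightings. -/
structure WeightedClone (D : Type*) [Finite D] where
  clone : OperationClone D
  weightings : (k : ℕ) → Set (clone.Op k → ℚ)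
  weightings_zero : weightings 0 = ∅
  isWeighting : ∀ (k : ℕ), ∀ ω ∈ weightings k, OperationClone.IsWeighting ω
  nonempty : ∃ k : ℕ, (weightings k).Nonempty
  smul_mem : ∀ (k : ℕ) (c : ℚ), 0 ≤ c → ∀ ω ∈ weightings k, c • ω ∈ weightings k
  add_mem : ∀ (k : ℕ), ∀ ω₁ ∈ weightings k, ∀ ω₂ ∈ weightings k, ω₁ + ω₂ ∈ weightings k
  superpose_mem : ∀ (k l : ℕ), ∀ ω ∈ weightings k, ∀ g : Fin k → clone.Op l,
    OperationClone.IsWeighting (OperationClone.superposeWeighting ω g) →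
      OperationClone.superposeWeighting ω g ∈ weightings l

/-- A weighted clone is a rigid core if the only unary operation in its support clone is the
unary projection. -/
def WeightedClone.IsRigidCore {D : Type*} [Finite D] (W : WeightedClone D) : Prop :=
  W.clone.ops 1 = {Operation.proj D (0 : Fin 1)}

/-! Take a positive weighting of least arity `k` and average it over permutations of the variables,
so that every projection has weight `-1`. By minimality, identifying two variables turns each
operation in the support into a projection (`exists_minor_eq_proj`). Rigidity excludes `k = 1` and
gives idempotence for `k = 2`; for `k ≥ 4`, Świerczkowski's lemma yields semiprojections.

For `k = 3` each operation has one of eight types (`HasType`): majority, minority, one returned odd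
position (projection or semiprojection), or one non-returned odd position (Pixley). If some binary
weighting is nonzero, it is a multiple of a difference of projections, and any single nonprojection
can be made the whole support (`exists_supp_eq_singleton`); a Pixley operation generates a majority
operation. If all binary weightings vanish, the number of returned odd positions has weighted
average zero after subtracting `1` (`exists_count`). Without majority or minority operations this
kills the Pixley type. Otherwise all exceptional-variable operations are eliminated by solving a
linear system with a nonnegative matrix (`exists_weighting_of_const_type`), and counting forces the
weights `2` and `1`. -/

/-! ### Nonnegative matrices with small column sums. -/

/-- Summing the inequalities over `u` gives a nonpositive sum of the nonnegative terms `(r - column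
sum) * N t`, so each term vanishes. -/
theorem eq_zero_of_mul_le_sum_mul {ι : Type*} [Fintype ι] {Q : ι → ι → ℚ} {r : ℚ}
    (hcol : ∀ t, ∑ u, Q u t < r) {N : ι → ℚ} (hN : ∀ u, 0 ≤ N u)
    (h : ∀ u, r * N u ≤ ∑ t, Q u t * N t) : ∀ u, N u = 0 := by
  have h1 : ∑ t, (r - ∑ u, Q u t) * N t ≤ 0 := by
    have h2 := Finset.sum_le_sum fun u (_ : u ∈ Finset.univ) => h u
    rw [Finset.sum_comm] at h2
    simp only [sub_mul, Finset.sum_sub_distrib, Finset.sum_mul]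
    linarith
  have h3 : ∀ t ∈ Finset.univ, 0 ≤ (r - ∑ u, Q u t) * N t := fun t _ =>
    mul_nonneg (sub_nonneg.2 (hcol t).le) (hN t)
  have h4 := (Finset.sum_eq_zero_iff_of_nonneg h3).1 (le_antisymm h1 (Finset.sum_nonneg h3))
  intro u
  exact (mul_eq_zero.1 (h4 u (Finset.mem_univ u))).resolve_left (sub_pos.2 (hcol u)).ne'

/-- A nonnegative matrix with all column sums less than `r` has a nonnegative resolvent at `r`. -/
theorem exists_nonneg_mul_eq_add_sum {ι : Type*} [Fintype ι] {Q : ι → ι → ℚ} {r : ℚ} {v : ι → ℚ}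
    (hr : 0 < r) (hQ : ∀ u t, 0 ≤ Q u t) (hv : ∀ u, 0 ≤ v u) (hcol : ∀ t, ∑ u, Q u t < r) :
    ∃ c : ι → ℚ, (∀ t, 0 ≤ c t) ∧ ∀ u, r * c u = v u + ∑ t, Q u t * c t := by
  let L : (ι → ℚ) →ₗ[ℚ] (ι → ℚ) := r • LinearMap.id - Matrix.mulVecLin (Matrix.of Q)
  have hL : ∀ c u, L c u = r * c u - ∑ t, Q u t * c t := fun c u => by
    simp [L, Matrix.mulVec, dotProduct]
  have hinj : Function.Injective L := by
    rw [injective_iff_map_eq_zero]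
    intro c hc
    have h : ∀ u, |c u| = 0 := by
      refine eq_zero_of_mul_le_sum_mul hcol (fun u => abs_nonneg _) fun u => ?_
      have h1 : r * c u = ∑ t, Q u t * c t := by
        have := congrFun hc u
        rw [hL] at this
        simpa [sub_eq_zero] using this
      calc r * |c u| = |r * c u| := by rw [abs_mul, abs_of_pos hr]
        _ ≤ ∑ t, |Q u t * c t| := by rw [h1]; exact Finset.abs_sum_le_sum_abs _ _
        _ = ∑ t, Q u t * |c t| := by simp [abs_mul, abs_of_nonneg (hQ u _)]
    funext u
    simpa using h u
  obtain ⟨c, hc⟩ := LinearMap.injective_iff_surjective.1 hinj v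
  have hc' : ∀ u, r * c u = v u + ∑ t, Q u t * c t := fun u => by
    have := congrFun hc u
    rw [hL] at this
    linarith
  refine ⟨c, fun t => ?_, hc'⟩
  -- The negative part of the solution satisfies the same subinvariance inequality as `|c|` did for
  -- injectivity, because `v` and `Q` are nonnegative.
  have h : ∀ u, max (-c u) 0 = 0 := by
    refine eq_zero_of_mul_le_sum_mul hcol (fun u => le_max_right _ _) fun u => ?_
    have h0 : 0 ≤ ∑ t, Q u t * max (-c t) 0 :=
      Finset.sum_nonneg fun t _ => mul_nonneg (hQ u t) (le_max_right _ _)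
    rw [mul_max_of_nonneg _ _ hr.le, mul_zero]
    refine max_le ?_ h0
    have h1 : -(∑ t, Q u t * c t) ≤ ∑ t, Q u t * max (-c t) 0 := by
      rw [← Finset.sum_neg_distrib]
      refine Finset.sum_le_sum fun t _ => ?_
      rw [← mul_neg]
      exact mul_le_mul_of_nonneg_left (le_max_left _ _) (hQ u t)
    linarith [hc' u, hv u]
  have := h t
  have := le_max_left (-c t) 0
  linarith

/-! ### Identification of variables. -/

namespace Operation

variable {D : Type*} {k : ℕ}

theorem proj_injective [Nontrivial D] : Function.Injective (proj D : Fin k → Operation D k) := by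
  classical
  intro i j h
  obtain ⟨a, b, hab⟩ := exists_pair_ne D
  by_contra hij
  have := congrFun h (Function.update (fun _ => a) i b)
  simp only [proj, Function.update_self, Function.update_of_ne (Ne.symm hij)] at this
  exact hab this.symm

/-- Świerczkowski's lemma: if all identifications of two variables turn an operation of arity at
least four into a projection, then they are all compatible with one fixed projection. -/
theorem exists_forall_not_injective_eq [Nontrivial D] (hk : 4 ≤ k) {f : Operation D k}
    (hf : ∀ i j, i ≠ j → ∃ l, ∀ x : Fin k → D, x i = x j → f x = x l) :
    ∃ l, ∀ x : Fin k → D, ¬ Function.Injective x → f x = x l := by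
  classical
  obtain ⟨a, b, hab⟩ := exists_pair_ne D
  -- A two-valued tuple, coded by a set `p` of positions that separates neither `i, j` nor `m, n`,
  -- evaluates `f` through both identifications, so `l` and `l'` lie on the same side of `p`.
  have key : ∀ {i j l m n l' : Fin k}, (∀ x : Fin k → D, x i = x j → f x = x l) →
      (∀ x : Fin k → D, x m = x n → f x = x l') → ∀ p : Fin k → Prop, (p i ↔ p j) →
      (p m ↔ p n) → (p l ↔ p l') := by
    intro i j l m n l' h h' p hij hmn
    have h1 := h (fun q => if p q then a else b) (by simp [hij])
    have h2 := h' (fun q => if p q then a else b) (by simp [hmn])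
    rw [h1] at h2
    by_cases hl : p l <;> by_cases hl' : p l' <;> simp_all
  by_cases hex : ∃ i j l, i ≠ j ∧ l ≠ i ∧ l ≠ j ∧ ∀ x : Fin k → D, x i = x j → f x = x l
  · obtain ⟨i, j, l, hij, hli, hlj, h⟩ := hex
    have h1 : ∀ m n, m ≠ n → l ≠ m → l ≠ n → ∀ x : Fin k → D, x m = x n → f x = x l := by
      intro m n hmn hlm hln
      obtain ⟨l', h'⟩ := hf m n hmn
      have := (key h h' (fun q => q = l) (by simp [hli.symm, hlj.symm])
        (by simp [hlm.symm, hln.symm])).1 rfl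
      exact this ▸ h'
    have h2 : ∀ n, n ≠ l → ∀ x : Fin k → D, x l = x n → f x = x l := by
      intro n hn
      -- Arity at least four leaves two positions outside `{l, n}`; comparing with their
      -- identification, via the set `{l, n}`, shows that `f` returns `l` or `n`, which agree here.
      obtain ⟨m, hm, m', hm', hmm⟩ : ∃ m ∈ ({l, n} : Finset (Fin k))ᶜ,
          ∃ m' ∈ ({l, n} : Finset (Fin k))ᶜ, m ≠ m' := by
        rw [← Finset.one_lt_card, Finset.card_compl, Fintype.card_fin]
        have := Finset.card_le_two (a := l) (b := n)
        omega
      simp only [Finset.mem_compl, Finset.mem_insert, Finset.mem_singleton, not_or] at hm hm'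
      obtain ⟨l', h'⟩ := hf l n hn.symm
      have := (key (h1 m m' hmm (Ne.symm hm.1) (Ne.symm hm'.1)) h' (fun q => q = l ∨ q = n)
        (by simp [hm, hm']) (by simp)).1 (Or.inl rfl)
      intro x hx
      rcases this with rfl | rfl
      · exact h' x hx
      · rw [h' x hx, hx]
    refine ⟨l, fun x hx => ?_⟩
    obtain ⟨m, n, hmn, hne⟩ := Function.not_injective_iff.1 hx
    by_cases hm : l = m
    · subst hm
      exact h2 n hne.symm x hmn
    · by_cases hn : l = n
      · subst hn
        exact h2 m hne x hmn.symm
      · exact h1 m n hne hm hn x hmn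
  -- Now each identification returns one of the identified variables, which is contradictory for the
  -- disjoint pairs `0, 1` and `2, 3`.
  · push Not at hex
    exfalso
    have h01 : (⟨0, by omega⟩ : Fin k) ≠ ⟨1, by omega⟩ := by simp
    have h23 : (⟨2, by omega⟩ : Fin k) ≠ ⟨3, by omega⟩ := by simp
    obtain ⟨l, hl⟩ := hf _ _ h01
    obtain ⟨l', hl'⟩ := hf _ _ h23
    have h1 : l.1 < 2 := by
      by_contra h
      obtain ⟨x, hx, hne⟩ := hex _ _ l h01 (by rintro rfl; simp at h) (by rintro rfl; simp at h)
      exact hne (hl x hx)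
    have h2 : l'.1 = 2 ∨ l'.1 = 3 := by
      by_contra h
      obtain ⟨x, hx, hne⟩ := hex _ _ l' h23 (by rintro rfl; simp at h) (by rintro rfl; simp at h)
      exact hne (hl' x hx)
    have := (key hl hl' (fun q => q.1 < 2) (by simp) (by simp)).1 h1
    omega

end Operation

/-! ### Superposition of operations and of weight functions. -/

namespace OperationClone

open Operation

variable {D : Type*} {C : OperationClone D} {k l m : ℕ}

/-- The superposition `f[g₁, …, g_k]` inside the clone. -/
def comp (f : C.Op k) (g : Fin k → C.Op l) : C.Op l :=
  ⟨f.1.superpose fun i => (g i).1, C.superpose_mem k l f.1 _ f.2 fun i => (g i).2⟩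

/-- The projections as elements of the clone. -/
def pr (C : OperationClone D) (i : Fin k) : C.Op k := ⟨proj D i, C.proj_mem k i⟩

theorem comp_apply (f : C.Op k) (g : Fin k → C.Op l) (x : Fin l → D) :
    (comp f g).1 x = f.1 fun i => (g i).1 x := rfl

theorem pr_apply (i : Fin k) (x : Fin k → D) : (pr C i).1 x = x i := rfl

@[simp] theorem comp_pr (f : C.Op k) : comp f (pr C) = f := Subtype.ext rfl

@[simp] theorem pr_comp (i : Fin k) (g : Fin k → C.Op l) : comp (pr C i) g = g i := Subtype.ext rfl

theorem isProjection_iff {f : C.Op k} : f.1.IsProjection ↔ ∃ i, f = pr C i :=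
  exists_congr fun i => (Subtype.ext_iff (a1 := f) (a2 := pr C i)).symm

theorem isProjection_pr (i : Fin k) : (pr C i).1.IsProjection := ⟨i, rfl⟩

theorem pr_injective [Nontrivial D] : Function.Injective (pr C : Fin k → C.Op k) := fun _ _ h =>
  proj_injective (Subtype.ext_iff.1 h)

/-- Renaming of the variables. -/
def rename (σ : Equiv.Perm (Fin k)) (f : C.Op k) : C.Op k := comp f fun i => pr C (σ i)

theorem rename_apply (σ : Equiv.Perm (Fin k)) (f : C.Op k) (x : Fin k → D) :
    (rename σ f).1 x = f.1 fun i => x (σ i) := rfl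

@[simp] theorem rename_one (f : C.Op k) : rename 1 f = f := Subtype.ext rfl

theorem rename_rename (σ τ : Equiv.Perm (Fin k)) (f : C.Op k) :
    rename σ (rename τ f) = rename (σ * τ) f := rfl

@[simp] theorem rename_pr (σ : Equiv.Perm (Fin k)) (i : Fin k) :
    rename σ (pr C i) = pr C (σ i) := Subtype.ext rfl

theorem rename_eq_iff {σ : Equiv.Perm (Fin k)} {f g : C.Op k} :
    rename σ f = g ↔ f = rename σ⁻¹ g := by
  constructor <;> rintro rfl <;> simp [rename_rename]

theorem isProjection_rename {σ : Equiv.Perm (Fin k)} {f : C.Op k} :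
    (rename σ f).1.IsProjection ↔ f.1.IsProjection := by
  simp only [isProjection_iff, rename_eq_iff, rename_pr]
  constructor
  · rintro ⟨i, h⟩
    exact ⟨_, h⟩
  · rintro ⟨i, h⟩
    exact ⟨σ i, by simpa using h⟩

/-- The sum of a weight function over all permutations of the variables. -/
def symmetrize (v : C.Op k → ℚ) (f : C.Op k) : ℚ := ∑ σ : Equiv.Perm (Fin k), v (rename σ f)

theorem symmetrize_rename (v : C.Op k → ℚ) (τ : Equiv.Perm (Fin k)) (f : C.Op k) :
    symmetrize v (rename τ f) = symmetrize v f := by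
  simp only [symmetrize, rename_rename]
  exact Equiv.sum_comp (Equiv.mulRight τ) fun σ => v (rename σ f)

variable [Finite D]

theorem superposeWeighting_apply [DecidableEq (C.Op l)] (ω : C.Op k → ℚ) (g : Fin k → C.Op l) (f' : C.Op l) :
    superposeWeighting ω g f' = ∑ f, if comp f g = f' then ω f else 0 := by
  classical
  rw [superposeWeighting, Finset.sum_filter]
  refine Finset.sum_congr rfl fun f _ => ?_
  exact if_congr (Subtype.ext_iff (a1 := comp f g) (a2 := f')).symm rfl rfl

/-- `superposeWeighting ω g` is the pushforward of `ω` along `f ↦ comp f g`; this is the change of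
variables formula. -/
theorem sum_superposeWeighting_mul (ω : C.Op k → ℚ) (g : Fin k → C.Op l) (φ : C.Op l → ℚ) :
    ∑ f', superposeWeighting ω g f' * φ f' = ∑ f, ω f * φ (comp f g) := by
  classical
  simp only [superposeWeighting_apply, Finset.sum_mul, ite_mul, zero_mul]
  rw [Finset.sum_comm]
  simp

theorem sum_superposeWeighting (ω : C.Op k → ℚ) (g : Fin k → C.Op l) :
    ∑ f', superposeWeighting ω g f' = ∑ f, ω f := by
  simpa using sum_superposeWeighting_mul ω g fun _ => 1

theorem superposeWeighting_pr (ω : C.Op k → ℚ) : superposeWeighting ω (pr C) = ω := by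
  classical
  funext f
  simp only [superposeWeighting_apply, comp_pr]
  rw [Finset.sum_ite_eq' Finset.univ f ω]
  simp

theorem superposeWeighting_superposeWeighting (ω : C.Op k → ℚ) (g : Fin k → C.Op l)
    (h : Fin l → C.Op m) : superposeWeighting (superposeWeighting ω g) h =
      superposeWeighting ω fun i => comp (g i) h := by
  classical
  funext f'
  have := sum_superposeWeighting_mul ω g fun f => if comp f h = f' then 1 else 0
  simp only [mul_ite, mul_one, mul_zero] at this
  rw [superposeWeighting_apply, superposeWeighting_apply, this]
  rfl

theorem superposeWeighting_add (ω₁ ω₂ : C.Op k → ℚ) (g : Fin k → C.Op l) :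
    superposeWeighting (ω₁ + ω₂) g = superposeWeighting ω₁ g + superposeWeighting ω₂ g := by
  funext f'
  simp [superposeWeighting, Finset.sum_add_distrib]

theorem superposeWeighting_smul (c : ℚ) (ω : C.Op k → ℚ) (g : Fin k → C.Op l) :
    superposeWeighting (c • ω) g = c • superposeWeighting ω g := by
  funext f'
  simp [superposeWeighting, Finset.mul_sum]

theorem exists_of_superposeWeighting_neg {ω : C.Op k → ℚ} {g : Fin k → C.Op l} {f' : C.Op l}
    (h : superposeWeighting ω g f' < 0) : ∃ f, comp f g = f' ∧ ω f < 0 := by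
  classical
  by_contra! hn
  rw [superposeWeighting_apply] at h
  refine h.not_ge (Finset.sum_nonneg fun f _ => ?_)
  split_ifs with hf
  exacts [hn f hf, le_rfl]

theorem exists_of_superposeWeighting_pos {ω : C.Op k → ℚ} {g : Fin k → C.Op l} {f' : C.Op l}
    (h : 0 < superposeWeighting ω g f') : ∃ f, comp f g = f' ∧ 0 < ω f := by
  classical
  by_contra! hn
  rw [superposeWeighting_apply] at h
  refine h.not_ge (Finset.sum_nonpos fun f _ => ?_)
  split_ifs with hf
  exacts [hn f hf, le_rfl]

theorem superposeWeighting_pos {ω : C.Op k → ℚ} {g : Fin k → C.Op l} {f : C.Op k}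
    (hf : 0 < ω f) (h : ∀ f₁, comp f₁ g = comp f g → 0 ≤ ω f₁) :
    0 < superposeWeighting ω g (comp f g) := by
  classical
  rw [superposeWeighting_apply]
  refine Finset.sum_pos' (fun f₁ _ => ?_) ⟨f, Finset.mem_univ f, by simpa using hf⟩
  split_ifs with h1
  exacts [h f₁ h1, le_rfl]

theorem IsWeighting.superposeWeighting {ω : C.Op k → ℚ} (hω : IsWeighting ω)
    {g : Fin k → C.Op l} (hg : ∀ i, (g i).1.IsProjection) :
    IsWeighting (superposeWeighting ω g) := by
  refine ⟨fun f' hf' => ?_, by rw [sum_superposeWeighting, hω.2]⟩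
  obtain ⟨f, rfl, hf⟩ := exists_of_superposeWeighting_neg hf'
  obtain ⟨i, rfl⟩ := isProjection_iff.1 (hω.1 f hf)
  exact hg i

theorem superposeWeighting_rename (ω : C.Op k → ℚ) (σ : Equiv.Perm (Fin k)) (f : C.Op k) :
    superposeWeighting ω (fun i => pr C (σ i)) f = ω (rename σ⁻¹ f) := by
  classical
  rw [superposeWeighting_apply]
  change (∑ f', if rename σ f' = f then ω f' else 0) = _
  simp [rename_eq_iff]

theorem symmetrize_eq_sum (v : C.Op k → ℚ) : symmetrize v =
    ∑ σ : Equiv.Perm (Fin k), superposeWeighting v fun i => pr C (σ i) := by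
  funext f
  rw [Finset.sum_apply, symmetrize, ← Equiv.sum_comp (Equiv.inv _)]
  simp [superposeWeighting_rename]

end OperationClone

/-! ### The cone of improper superpositions. -/

namespace WeightedClone

open OperationClone Operation

variable {D : Type*} [Finite D] (W : WeightedClone D) {k l : ℕ}

theorem superpose_pr_mem {ω : W.clone.Op k → ℚ} (hω : ω ∈ W.weightings k)
    {g : Fin k → W.clone.Op l} (hg : ∀ i, (g i).1.IsProjection) :
    superposeWeighting ω g ∈ W.weightings l :=
  W.superpose_mem k l ω hω g ((W.isWeighting k ω hω).superposeWeighting hg)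

/-- The cone of all, possibly improper, superpositions of weightings of `W`. -/
def improperCone (l : ℕ) [NeZero l] : AddSubmonoid (W.clone.Op l → ℚ) where
  carrier := {v | ∃ k, ∃ ω ∈ W.weightings k, ∃ g, v = superposeWeighting ω g}
  zero_mem' := by
    obtain ⟨k, ω, hω⟩ := W.nonempty
    refine ⟨k, (0 : ℚ) • ω, W.smul_mem k 0 le_rfl ω hω, fun _ => pr _ 0, ?_⟩
    rw [superposeWeighting_smul, zero_smul]
  add_mem' := by
    rintro _ _ ⟨k₁, ω₁, h₁, g₁, rfl⟩ ⟨k₂, ω₂, h₂, g₂, rfl⟩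
    -- Placing the two weightings on disjoint blocks of variables makes their sum one weighting of
    -- `W`, into which `g₁` and `g₂` are substituted simultaneously.
    refine ⟨k₁ + k₂, _, W.add_mem _ _
      (W.superpose_pr_mem h₁ (g := fun i => pr _ (Fin.castAdd k₂ i)) fun i => isProjection_pr _) _
      (W.superpose_pr_mem h₂ (g := fun i => pr _ (Fin.natAdd k₁ i)) fun i => isProjection_pr _),
      Fin.append g₁ g₂, ?_⟩
    simp [superposeWeighting_add, superposeWeighting_superposeWeighting]

variable [NeZero l] {W}

theorem mem_improperCone {ω : W.clone.Op k → ℚ} (hω : ω ∈ W.weightings k)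
    (g : Fin k → W.clone.Op l) : superposeWeighting ω g ∈ W.improperCone l := ⟨k, ω, hω, g, rfl⟩

theorem mem_improperCone_of_mem {ω : W.clone.Op l → ℚ} (hω : ω ∈ W.weightings l) :
    ω ∈ W.improperCone l := by
  simpa [superposeWeighting_pr] using mem_improperCone hω (pr _)

theorem smul_mem_improperCone {v : W.clone.Op l → ℚ} (hv : v ∈ W.improperCone l) {c : ℚ}
    (hc : 0 ≤ c) : c • v ∈ W.improperCone l := by
  obtain ⟨k, ω, hω, g, rfl⟩ := hv
  exact ⟨k, c • ω, W.smul_mem k c hc ω hω, g, (superposeWeighting_smul c ω g).symm⟩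

theorem superposeWeighting_mem_improperCone [NeZero k] {v : W.clone.Op k → ℚ}
    (hv : v ∈ W.improperCone k) (h : Fin k → W.clone.Op l) :
    superposeWeighting v h ∈ W.improperCone l := by
  obtain ⟨k, ω, hω, g, rfl⟩ := hv
  exact ⟨k, ω, hω, _, superposeWeighting_superposeWeighting ω g h⟩

theorem sum_eq_zero_of_mem_improperCone {v : W.clone.Op l → ℚ} (hv : v ∈ W.improperCone l) :
    ∑ f, v f = 0 := by
  obtain ⟨k, ω, hω, g, rfl⟩ := hv
  rw [sum_superposeWeighting, (W.isWeighting k ω hω).2]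

/-- Intermediate improper terms are harmless: a member of the cone is a single superposition of a
weighting of `W`, so only the final result has to be proper. -/
theorem mem_weightings_of_mem_improperCone {v : W.clone.Op l → ℚ} (hv : v ∈ W.improperCone l)
    (h : ∀ f, v f < 0 → f.1.IsProjection) : v ∈ W.weightings l := by
  have hs := sum_eq_zero_of_mem_improperCone hv
  obtain ⟨k, ω, hω, g, rfl⟩ := hv
  exact W.superpose_mem k l ω hω g ⟨h, hs⟩

theorem symmetrize_mem_improperCone {v : W.clone.Op l → ℚ} (hv : v ∈ W.improperCone l) :
    symmetrize v ∈ W.improperCone l := by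
  rw [symmetrize_eq_sum]
  exact AddSubmonoid.sum_mem _ fun σ _ => superposeWeighting_mem_improperCone hv _

/-- A weight function of the cone that is nonnegative on, and not identically zero on, the
operations that are not projections gives, after symmetrization, a weighting that has no
projections in its support and the same weight `-1` on every projection. -/
theorem exists_balanced {v : W.clone.Op l → ℚ} (hv : v ∈ W.improperCone l)
    (h0 : ∀ f : W.clone.Op l, ¬ f.1.IsProjection → 0 ≤ symmetrize v f) {f₀ : W.clone.Op l}
    (hpos : 0 < symmetrize v f₀) :
    ∃ ω ∈ W.weightings l, (∀ i, ω (pr _ i) = -1) ∧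
      ∃ c : ℚ, 0 < c ∧ ∀ f, ω f = c * symmetrize v f := by
  classical
  set s := symmetrize v with hs
  have hsm : s ∈ W.improperCone l := symmetrize_mem_improperCone hv
  have hpr : ∀ i, s (pr _ i) = s (pr _ 0) := fun i => by
    rw [hs, ← symmetrize_rename v (Equiv.swap i 0) (pr _ i), rename_pr, Equiv.swap_apply_left]
  -- Otherwise `s` would be nonnegative everywhere and positive at `f₀`, although its total is zero.
  have hneg : s (pr _ 0) < 0 := by
    by_contra! hn
    have hall : ∀ f ∈ Finset.univ, 0 ≤ s f := fun f _ => by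
      by_cases hf : f.1.IsProjection
      · obtain ⟨i, rfl⟩ := isProjection_iff.1 hf
        rwa [hpr]
      · exact h0 f hf
    exact (Finset.sum_pos' hall ⟨f₀, Finset.mem_univ _, hpos⟩).ne'
      (sum_eq_zero_of_mem_improperCone hsm)
  have hc : 0 < (-s (pr _ 0))⁻¹ := inv_pos.2 (neg_pos.2 hneg)
  refine ⟨(-s (pr _ 0))⁻¹ • s, mem_weightings_of_mem_improperCone
    (smul_mem_improperCone hsm hc.le) fun f hf => ?_, fun i => ?_, _, hc, fun f => rfl⟩
  · by_contra hn
    exact hf.not_ge (mul_nonneg hc.le (h0 f hn))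
  · rw [Pi.smul_apply, hpr i, smul_eq_mul, inv_neg, neg_mul, inv_mul_cancel₀ hneg.ne]

end WeightedClone

/-! ### Types of ternary operations. -/

namespace Operation

variable {D : Type*} {f : Operation D 3} {u u' : Fin 3 → Bool}

/-- All identifications of two variables turn `f` into a projection; `u d` tells whether `f` returns
the entry at `d` on the tuples whose other two entries agree. -/
def HasType (f : Operation D 3) (u : Fin 3 → Bool) : Prop :=
  ∀ d x y, f (Function.update (fun _ => x) d y) = if u d then y else x

theorem HasType.unique [Nontrivial D] (h : f.HasType u) (h' : f.HasType u') : u = u' := by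
  obtain ⟨a, b, hab⟩ := exists_pair_ne D
  funext d
  have := (h d a b).symm.trans (h' d a b)
  cases hu : u d <;> cases hu' : u' d <;> simp_all

theorem update_const_zero (x y : D) : Function.update (fun _ : Fin 3 => x) 0 y = ![y, x, x] := by
  funext j; fin_cases j <;> rfl

theorem update_const_one (x y : D) : Function.update (fun _ : Fin 3 => x) 1 y = ![x, y, x] := by
  funext j; fin_cases j <;> rfl

theorem update_const_two (x y : D) : Function.update (fun _ : Fin 3 => x) 2 y = ![x, x, y] := by
  funext j; fin_cases j <;> rfl

theorem hasType_false_iff : f.HasType (fun _ => false) ↔ f.IsMajority := by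
  simp only [HasType, IsMajority, Fin.forall_fin_succ, Fin.succ_zero_eq_one, Fin.succ_one_eq_two,
    IsEmpty.forall_iff, update_const_zero, update_const_one, update_const_two, Bool.false_eq_true,
    if_false]
  exact ⟨fun h x y => ⟨h.2.2.1 x y, h.2.1 x y, h.1 x y⟩,
    fun h => ⟨fun x y => (h x y).2.2, fun x y => (h x y).2.1, fun x y => (h x y).1, trivial⟩⟩

theorem hasType_true_iff : f.HasType (fun _ => true) ↔ f.IsMinority := by
  simp only [HasType, IsMinority, Fin.forall_fin_succ, Fin.succ_zero_eq_one, Fin.succ_one_eq_two,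
    IsEmpty.forall_iff, update_const_zero, update_const_one, update_const_two, if_true]
  exact ⟨fun h x y => ⟨h.2.2.1 x y, h.2.1 x y, h.1 x y⟩,
    fun h => ⟨fun x y => (h x y).2.2, fun x y => (h x y).2.1, fun x y => (h x y).1, trivial⟩⟩

theorem hasType_proj (i : Fin 3) : (proj D i).HasType fun d => decide (d = i) := by
  intro d x y
  simp only [proj, Function.update_apply, eq_comm (a := i), decide_eq_true_eq]

theorem exists_hasType (hf : ∀ i j, i ≠ j → ∃ l, ∀ x : Fin 3 → D, x i = x j → f x = x l) :
    ∃ u, f.HasType u := by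
  have h : ∀ d : Fin 3, ∃ b : Bool, ∀ x y,
      f (Function.update (fun _ => x) d y) = if b then y else x := by
    intro d
    have h1 : d + 1 ≠ d := by revert d; decide
    have h2 : d + 2 ≠ d := by revert d; decide
    obtain ⟨l, hl⟩ := hf (d + 1) (d + 2) (by revert d; decide)
    refine ⟨decide (l = d), fun x y => ?_⟩
    rw [hl _ (by rw [Function.update_of_ne h1, Function.update_of_ne h2])]
    simp [Function.update_apply]
  choose u hu using h
  exact ⟨u, hu⟩

theorem HasType.isSemiprojection {i : Fin 3} (h : f.HasType fun d => decide (d = i))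
    (hf : ¬ f.IsProjection) : f.IsSemiprojection := by
  refine ⟨le_rfl, hf, i, fun x hx => ?_⟩
  obtain ⟨a, b, hab, hne⟩ := Function.not_injective_iff.1 hx
  obtain ⟨d, hd⟩ : ∃ d, ∀ m : Fin 3, m = a ∨ m = b ∨ m = d := by
    revert hne; clear hab; revert a b; decide
  have hxd : x = Function.update (fun _ => x a) d (x d) := by
    funext m
    by_cases hm : m = d
    · subst hm; simp
    · rw [Function.update_of_ne hm]
      rcases hd m with rfl | rfl | h
      exacts [rfl, hab.symm, absurd h hm]
  conv_lhs => rw [hxd, h d]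
  by_cases hdi : d = i
  · simp [hdi]
  · rcases hd i with rfl | rfl | h
    · simp [hdi]
    · simpa [hdi] using hab
    · exact absurd h.symm hdi

/-- The types of ternary operations: majority and minority, or one exceptional variable. -/
theorem type_cases (u : Fin 3 → Bool) :
    (∃ b, u = fun _ => b) ∨ ∃ i b, u = fun d => decide (d = i) != b := by
  revert u; decide

theorem type_const_ne (b : Bool) (i : Fin 3) (b' : Bool) :
    (fun _ => b) ≠ fun d : Fin 3 => decide (d = i) != b' := by
  revert b i b'; decide

end Operation

/-! ### Types under renaming and superposition. -/

namespace OperationClone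

open Operation

variable {D : Type*} {C : OperationClone D}

theorem HasType.rename {f : C.Op 3} {u : Fin 3 → Bool} (h : f.1.HasType u)
    (σ : Equiv.Perm (Fin 3)) : (rename σ f).1.HasType fun d => u (σ⁻¹ d) := by
  intro d x y
  rw [rename_apply, ← h]
  refine congrArg f.1 (funext fun j => ?_)
  simp only [Function.update_apply, Equiv.Perm.eq_inv_iff_eq]

/-- On a tuple with one odd entry, the values of the `t j` form that same tuple, or, if `b` is true,
the tuple with the roles of `x` and `y` exchanged. In particular, constant types stay constant. -/
theorem HasType.comp {f : C.Op 3} {u : Fin 3 → Bool} (h : f.1.HasType u) {t : Fin 3 → C.Op 3}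
    {b : Bool} (ht : ∀ j, (t j).1.HasType fun d => decide (d = j) != b) :
    (comp f t).1.HasType fun d => u d != b := by
  intro d x y
  have h1 : ∀ j, (t j).1 (Function.update (fun _ => x) d y) =
      if b then Function.update (fun _ => y) d x j else Function.update (fun _ => x) d y j := by
    intro j
    rw [ht]
    by_cases hj : j = d
    · subst hj; cases b <;> simp
    · rw [Function.update_of_ne hj, Function.update_of_ne hj]
      cases b <;> simp [Ne.symm hj]
  rw [comp_apply]
  simp only [h1]
  cases b
  · simpa using h d x y
  · simp only [if_true]
    rw [h d y x]
    by_cases hu : u d = true <;> simp [hu]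

/-- For `i = 1` this is the classical term `p(x, p(x, y, z), z)`. If the odd entry sits at `i`, the
inner `p` repairs it and all arguments agree; if it sits at `d ≠ i`, the inner `p` copies it to `i`,
so the third position becomes the odd one and is returned. -/
theorem HasType.majority_of_pixley {p : C.Op 3} {i : Fin 3}
    (h : p.1.HasType fun d => decide (d = i) != true) :
    (OperationClone.comp p fun j => if j = i then p else pr C j).1.IsMajority := by
  rw [← hasType_false_iff]
  intro d x y
  have h1 : ∀ j, ((if j = i then p else pr C j) : C.Op 3).1 (Function.update (fun _ => x) d y) =
      if j = i then (if d = i then x else y) else Function.update (fun _ => x) d y j := by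
    intro j
    split_ifs with hj hd
    · rw [h]; simp [hd]
    · rw [h]; simp [hd]
    · rfl
  rw [comp_apply]
  simp only [h1, Bool.false_eq_true, if_false]
  by_cases hd : d = i
  · subst hd
    have := h d x x
    simp only [if_true] at this ⊢
    simp only [ite_self] at this
    convert this using 2
    funext j
    by_cases hj : j = d <;> simp [hj]
  · have third : ∀ d i : Fin 3, d ≠ i →
        ∃ r : Fin 3, r ≠ i ∧ r ≠ d ∧ ∀ j, j ≠ r → j = i ∨ j = d := by decide
    obtain ⟨r, hri, hrd, hr⟩ := third d i hd
    have := h r y x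
    rw [if_pos (by simp [hri])] at this
    convert this using 2
    funext j
    by_cases hj : j = r
    · subst hj; simp [hri, hrd]
    · rcases hr j hj with rfl | rfl
      · simp [hd, Function.update_of_ne hj]
      · simp [hd, Function.update_of_ne hj]

variable [Finite D]

theorem sum_eq_sum_add_sum_pr [Nontrivial D] {k : ℕ} (F : C.Op k → ℚ)
    [∀ f : C.Op k, Decidable f.1.IsProjection] :
    ∑ f, F f = ∑ f, (if f.1.IsProjection then 0 else F f) + ∑ i, F (pr C i) := by
  classical
  rw [← Finset.sum_filter_add_sum_filter_not Finset.univ (fun f : C.Op k => f.1.IsProjection),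
    add_comm]
  congr 1
  · rw [Finset.sum_filter]
    exact Finset.sum_congr rfl fun f _ => by split_ifs <;> rfl
  · rw [← Finset.sum_image (f := F) (g := pr C) (s := Finset.univ) pr_injective.injOn]
    refine Finset.sum_congr ?_ fun _ _ => rfl
    ext f
    simp [isProjection_iff, eq_comm]

end OperationClone

/-! ### Consequences of having no positive weighting of smaller arity. -/

namespace WeightedClone

open OperationClone Operation

variable {D : Type*} [Finite D] {W : WeightedClone D}

/-- If the minor of `f` were not a projection, no projection would have the same minor, so no
negative weight could cancel that of `f`; the identified `n`-ary weighting would be positive. -/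
theorem exists_minor_eq_proj {n : ℕ} [NeZero n]
    (hn : ∀ ω ∈ W.weightings n, ¬ IsPositive ω) {ω : W.clone.Op (n + 1) → ℚ}
    (hω : ω ∈ W.weightings (n + 1)) {f : W.clone.Op (n + 1)} (hf : 0 < ω f) {i j : Fin (n + 1)}
    (hij : i ≠ j) : ∃ l, ∀ x : Fin (n + 1) → D, x i = x j → f.1 x = x l := by
  obtain ⟨j', rfl⟩ := Fin.exists_succAbove_eq hij.symm
  let π : Fin (n + 1) → Fin n := i.insertNth j' id
  let g : Fin (n + 1) → W.clone.Op n := fun m => pr _ (π m)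
  have hp : (comp f g).1.IsProjection := by
    by_contra hnp
    refine hn _ (W.superpose_pr_mem hω (g := g) fun m => isProjection_pr _)
      ⟨comp f g, superposeWeighting_pos hf fun f₁ h₁ => ?_, hnp⟩
    by_contra! hneg
    obtain ⟨m, rfl⟩ := isProjection_iff.1 ((W.isWeighting _ ω hω).1 f₁ hneg)
    exact hnp (h₁ ▸ isProjection_pr (π m))
  obtain ⟨l, hl⟩ := isProjection_iff.1 hp
  refine ⟨i.succAbove l, fun x hx => ?_⟩
  have h1 : (comp f g).1 (fun m => x (i.succAbove m)) = x (i.succAbove l) := by rw [hl]; rfl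
  rw [← h1, comp_apply]
  refine congrArg f.1 (funext fun m => ?_)
  change x m = x (i.succAbove (π m))
  rcases Fin.eq_self_or_eq_succAbove i m with rfl | ⟨m', rfl⟩
  · simp [π, hx]
  · simp [π]

theorem exists_balanced_of_isPositive {k : ℕ} [NeZero k] {ω : W.clone.Op k → ℚ}
    (hω : ω ∈ W.weightings k) (hpos : IsPositive ω) :
    ∃ ω' ∈ W.weightings k, (∀ i, ω' (pr _ i) = -1) ∧ ∃ f, 0 < ω' f := by
  obtain ⟨f, hf, hfp⟩ := hpos
  have h0 : ∀ f : W.clone.Op k, ¬ f.1.IsProjection → ∀ σ ∈ Finset.univ, 0 ≤ ω (rename σ f) :=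
    fun f hfp σ _ => le_of_not_gt fun h =>
      hfp (isProjection_rename.1 ((W.isWeighting _ ω hω).1 _ h))
  have hs : 0 < symmetrize ω f := Finset.sum_pos' (h0 f hfp) ⟨1, Finset.mem_univ _, hf⟩
  obtain ⟨ω', hω', hpr, c, hc, h⟩ := exists_balanced (mem_improperCone_of_mem hω)
    (fun f hf => Finset.sum_nonneg (h0 f hf)) hs
  exact ⟨ω', hω', hpr, f, by rw [h]; positivity⟩

/-- With no positive binary weighting, `β` is a positive multiple of one projection minus the other.
Substituting `f` for the positive one and a projection for the negative one leaves a multiple of `f`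
minus a projection. -/
theorem exists_supp_eq_singleton [Nontrivial D] (h2 : ∀ ω ∈ W.weightings 2, ¬ IsPositive ω)
    {β : W.clone.Op 2 → ℚ} (hβ : β ∈ W.weightings 2) (hne : β ≠ 0) {l : ℕ} [NeZero l]
    {f : W.clone.Op l} (hf : ¬ f.1.IsProjection) :
    ∃ ω ∈ W.weightings l, supp ω = {f} := by
  classical
  have hw := W.isWeighting _ β hβ
  have h0 : ∀ h : W.clone.Op 2, ¬ h.1.IsProjection → β h = 0 := fun h hh =>
    le_antisymm (le_of_not_gt fun hp => h2 β hβ ⟨h, hp, hh⟩) (le_of_not_gt fun hn => hh (hw.1 h hn))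
  have hsum : β (pr _ 0) + β (pr _ 1) = 0 := by
    have := hw.2
    rw [sum_eq_sum_add_sum_pr, Fin.sum_univ_two, Finset.sum_eq_zero, zero_add] at this
    · exact this
    · intro h _
      split_ifs with hh
      exacts [rfl, h0 h hh]
  obtain ⟨i, hi⟩ : ∃ i, 0 < β (pr _ i) := by
    by_contra! hn
    refine hne (funext fun h => ?_)
    by_cases hh : h.1.IsProjection
    · obtain ⟨j, rfl⟩ := isProjection_iff.1 hh
      have h0 := hn 0
      have h1 := hn 1
      obtain rfl | rfl : j = 0 ∨ j = 1 := by omega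
      · exact le_antisymm h0 (by rw [Pi.zero_apply]; linarith)
      · exact le_antisymm h1 (by rw [Pi.zero_apply]; linarith)
    · exact h0 h hh
  have hi' : ∀ j, j ≠ i → β (pr _ j) < 0 := by
    intro j hj
    obtain ⟨rfl, rfl⟩ | ⟨rfl, rfl⟩ : (i = 0 ∧ j = 1) ∨ (i = 1 ∧ j = 0) := by omega
    · linarith
    · linarith
  let g : Fin 2 → W.clone.Op l := fun j => if j = i then f else pr _ 0
  have hneg : ∀ h, β h < 0 → comp h g = pr _ 0 := by
    intro h hh
    obtain ⟨j, rfl⟩ := isProjection_iff.1 (hw.1 h hh)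
    have : j ≠ i := by rintro rfl; exact hh.not_gt hi
    simp [g, this]
  refine ⟨superposeWeighting β g, mem_weightings_of_mem_improperCone (mem_improperCone hβ g)
    fun f' hf' => ?_, Set.eq_singleton_iff_unique_mem.2 ⟨?_, fun f' hf' => ?_⟩⟩
  · obtain ⟨h, rfl, hh⟩ := exists_of_superposeWeighting_neg hf'
    exact hneg h hh ▸ isProjection_pr 0
  · have hgi : comp (pr _ i) g = f := by simp [g]
    have := superposeWeighting_pos (g := g) hi fun h hh => by
      by_contra! hlt
      rw [hgi, hneg h hlt] at hh
      exact hf (hh ▸ isProjection_pr 0)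
    rwa [hgi] at this
  · obtain ⟨h, rfl, hh⟩ := exists_of_superposeWeighting_pos hf'
    have hp : h.1.IsProjection := by
      by_contra hn
      exact hh.ne' (h0 h hn)
    obtain ⟨j, rfl⟩ := isProjection_iff.1 hp
    have : j = i := by
      by_contra hj
      exact hh.not_gt (hi' j hj)
    simp [g, this]

/-- If all binary weightings vanish, then counting the variables that typed ternary operations
return on tuples with two equal entries gives a linear relation for ternary weightings. -/
theorem exists_count [Nontrivial D] (h2 : ∀ ω ∈ W.weightings 2, ω = 0) :
    ∃ φ : W.clone.Op 3 → ℚ,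
      (∀ (u : Fin 3 → Bool) (f : W.clone.Op 3), f.1.HasType u →
        φ f = ∑ d, if u d then 1 else 0) ∧
      ∀ ω ∈ W.weightings 3, ∑ f, ω f * (φ f - 1) = 0 := by
  classical
  let g : Fin 3 → Fin 3 → W.clone.Op 2 := fun d j => if j = d then pr _ 1 else pr _ 0
  have hg : ∀ (d : Fin 3) (f : W.clone.Op 3) (z : Fin 2 → D),
      (comp f (g d)).1 z = f.1 (Function.update (fun _ => z 0) d (z 1)) := by
    intro d f z
    rw [comp_apply]
    refine congrArg f.1 (funext fun j => ?_)
    by_cases hj : j = d <;> simp [g, hj, pr_apply]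
  refine ⟨fun f => ∑ d, if comp f (g d) = pr _ 1 then 1 else 0, fun u f hf => ?_, fun ω hω => ?_⟩
  · refine Finset.sum_congr rfl fun d _ => if_congr ?_ rfl rfl
    constructor
    · intro h
      obtain ⟨a, b, hab⟩ := exists_pair_ne D
      have h1 := hg d f ![a, b]
      rw [h, hf] at h1
      by_contra hu
      simp [hu, pr_apply] at h1
      exact hab h1.symm
    · intro hu
      refine Subtype.ext (funext fun z => ?_)
      rw [hg, hf, if_pos hu]
      rfl
  · have hd : ∀ d, ∑ f, ω f * (if comp f (g d) = pr _ 1 then 1 else 0) = 0 := by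
      intro d
      have hm : superposeWeighting ω (g d) ∈ W.weightings 2 :=
        W.superpose_pr_mem hω fun j => by
          by_cases hj : j = d <;> simp only [g, hj, if_true, if_false] <;> exact isProjection_pr _
      rw [← sum_superposeWeighting_mul ω (g d) fun h => if h = pr _ 1 then 1 else 0, h2 _ hm]
      simp
    simp only [mul_sub, Finset.mul_sum, Finset.sum_sub_distrib, mul_one]
    rw [Finset.sum_comm, Finset.sum_eq_zero fun d _ => hd d, (W.isWeighting _ ω hω).2, sub_zero]

end WeightedClone

/-! ### The ternary case. -/

namespace WeightedClone

open OperationClone Operation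

variable {D : Type*} [Finite D] {W : WeightedClone D}

/-- Weight on majority and minority operations can be concentrated there: repeatedly substituting
operations with one exceptional variable into the weighting removes all of these. -/
theorem exists_weighting_of_const_type [Nontrivial D]
    (htyped : ∀ ω ∈ W.weightings 3, ∀ f, 0 < ω f → ∃ u, f.1.HasType u)
    {ω : W.clone.Op 3 → ℚ} (hω : ω ∈ W.weightings 3) (hpr : ∀ i, ω (pr _ i) = -1)
    {f₀ : W.clone.Op 3} (hf₀ : 0 < ω f₀) {b₀ : Bool} (hb₀ : f₀.1.HasType fun _ => b₀) :
    ∃ ω' ∈ W.weightings 3, (∀ i, ω' (pr _ i) = -1) ∧ (∃ f, 0 < ω' f) ∧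
      ∀ f, 0 < ω' f → ∃ b, f.1.HasType fun _ => b := by
  classical
  let Bad : W.clone.Op 3 → Prop := fun t =>
    ¬ t.1.IsProjection ∧ ∃ i b, t.1.HasType fun d => decide (d = i) != b
  have hconst : ∀ {f : W.clone.Op 3} {b : Bool}, f.1.HasType (fun _ => b) → ¬ Bad f := by
    rintro f b hf ⟨-, i, b', h⟩
    exact type_const_ne b i b' (hf.unique h)
  have hren : ∀ {f : W.clone.Op 3} (σ : Equiv.Perm (Fin 3)), Bad f → Bad (rename σ f) := by
    rintro f σ ⟨hp, i, b, h⟩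
    refine ⟨fun h => hp (isProjection_rename.1 h), σ i, b, ?_⟩
    have e : (fun d => decide (σ⁻¹ d = i) != b) = fun d => decide (d = σ i) != b := by
      funext d
      simp only [Equiv.Perm.inv_eq_iff_eq]
    exact e ▸ HasType.rename h σ
  have hren' : ∀ {f : W.clone.Op 3} (σ : Equiv.Perm (Fin 3)), Bad (rename σ f) → Bad f := by
    intro f σ h
    simpa [rename_rename] using hren σ⁻¹ h
  have hB : ∀ t : {t // Bad t}, ∃ i b, t.1.1.HasType fun d => decide (d = i) != b := fun t => t.2.2
  choose s b hs using hB
  -- Three copies of `t`, the `j`-th with its exceptional variable moved to position `j`, as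
  -- `HasType.comp` requires.
  let T : {t // Bad t} → Fin 3 → W.clone.Op 3 := fun t j => rename (Equiv.swap (s t) j) t.1
  have hTbad : ∀ t j, Bad (T t j) := fun t j => hren _ t.2
  have hT : ∀ t j, (T t j).1.HasType fun d => decide (d = j) != b t := by
    intro t j
    have := HasType.rename (hs t) (Equiv.swap (s t) j)
    simpa only [Equiv.swap_inv, Equiv.swap_apply_eq_iff, Equiv.swap_apply_left] using this
  have hnn : ∀ f : W.clone.Op 3, ¬ f.1.IsProjection → 0 ≤ ω f := fun f hf =>
    le_of_not_gt fun h => hf ((W.isWeighting _ ω hω).1 f h)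
  have hf₀p : ¬ f₀.1.IsProjection := fun h => by
    obtain ⟨i, rfl⟩ := isProjection_iff.1 h
    rw [hpr] at hf₀
    linarith
  let ωp : W.clone.Op 3 → ℚ := fun f => if f.1.IsProjection then 0 else ω f
  have hωp : ∀ f, 0 ≤ ωp f := fun f => by
    simp only [ωp]
    split_ifs with h
    exacts [le_rfl, hnn f h]
  have hωp3 : ∑ f, ωp f = 3 := by
    have := (W.isWeighting _ ω hω).2
    rw [sum_eq_sum_add_sum_pr] at this
    simp only [hpr, Finset.sum_const, Finset.card_univ, Fintype.card_fin] at this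
    simp only [ωp]
    norm_num at this
    linarith
  let n : {t // Bad t} → W.clone.Op 3 → ℚ := fun t => superposeWeighting ωp (T t)
  have hn : ∀ t u, 0 ≤ n t u := fun t u => le_of_not_gt fun h => by
    obtain ⟨f, -, hf⟩ := exists_of_superposeWeighting_neg h
    exact hf.not_ge (hωp f)
  -- The nonprojections contribute `n t`, while the three projections, each of weight `-1`, remove
  -- one unit at each `T t j`.
  have hr : ∀ t u, superposeWeighting ω (T t) u = n t u - ∑ j, if T t j = u then 1 else 0 := by
    intro t u
    simp only [n, superposeWeighting_apply]
    rw [sum_eq_sum_add_sum_pr, sub_eq_add_neg, ← Finset.sum_neg_distrib]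
    congr 1
    · refine Finset.sum_congr rfl fun f _ => ?_
      simp only [ωp]
      split_ifs <;> rfl
    · refine Finset.sum_congr rfl fun j _ => ?_
      rw [pr_comp, hpr]
      split_ifs <;> simp
  -- The nonprojections have total weight `3`, and some of it leaks out of the bad operations
  -- because `f₀` composed with `T t` has constant type.
  have hcol : ∀ t, ∑ u : {t // Bad t}, n t u < 3 := by
    intro t
    have h1 : ∑ u : {t // Bad t}, n t u = ∑ u, n t u * if Bad u then 1 else 0 := by
      simp only [mul_ite, mul_one, mul_zero]
      rw [← Finset.sum_filter]
      exact (Finset.sum_subtype _ (by simp) _).symm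
    rw [h1, sum_superposeWeighting_mul, ← hωp3]
    refine Finset.sum_lt_sum (fun f _ => ?_) ⟨f₀, Finset.mem_univ _, ?_⟩
    · split_ifs
      · rw [mul_one]
      · rw [mul_zero]; exact hωp f
    · rw [if_neg (hconst (HasType.comp hb₀ (hT t))), mul_zero]
      simpa [ωp, hf₀p] using hf₀
  -- The coefficients are chosen so that the bad weight `ω u + ∑ n t u * c t` equals `3 * c u`,
  -- exactly what the subtracted copies `T t j` remove after symmetrization.
  obtain ⟨c, hc, hcu⟩ := exists_nonneg_mul_eq_add_sum (Q := fun u t : {t // Bad t} => n t u)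
    (v := fun u : {t // Bad t} => ω u) three_pos (fun u t => hn t u) (fun u => hnn _ u.2.1) hcol
  let v : W.clone.Op 3 → ℚ := ω + ∑ t, c t • superposeWeighting ω (T t)
  have hv : v ∈ W.improperCone 3 := AddSubmonoid.add_mem _ (mem_improperCone_of_mem hω)
    (AddSubmonoid.sum_mem _ fun t _ => smul_mem_improperCone (mem_improperCone hω _) (hc t))
  have hvu : ∀ u, v u = ω u + ∑ t, n t u * c t -
      ∑ t, c t * ∑ j, if T t j = u then 1 else 0 := by
    intro u
    simp only [v, Pi.add_apply, Finset.sum_apply, Pi.smul_apply, smul_eq_mul, hr, mul_sub,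
      Finset.sum_sub_distrib, add_sub_assoc, mul_comm (c _) (n _ u)]
  have hgood : ∀ u, ¬ Bad u → ω u ≤ v u := by
    intro u hu
    have h1 : ∑ t, c t * ∑ j, (if T t j = u then (1 : ℚ) else 0) = 0 :=
      Finset.sum_eq_zero fun t _ => by
        rw [Finset.sum_eq_zero, mul_zero]
        intro j _
        rw [if_neg]
        rintro rfl
        exact hu (hTbad t j)
    rw [hvu, h1, sub_zero]
    linarith [Finset.sum_nonneg fun t (_ : t ∈ Finset.univ) => mul_nonneg (hn t u) (hc t)]
  have hbad : ∀ u, Bad u → symmetrize v u = 0 := by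
    intro u hu
    -- Each `T t j` is a renaming of `t`, so after summing over permutations the three copies count
    -- alike; hence the factor `3`.
    have h1 : ∀ t : {t // Bad t}, ∑ σ, ∑ j, (if T t j = rename σ u then (1 : ℚ) else 0) =
        ∑ σ, if t.1 = rename σ u then 3 else 0 := by
      intro t
      have h2 : ∀ j, ∑ σ, (if T t j = rename σ u then (1 : ℚ) else 0) =
          ∑ σ, if t.1 = rename σ u then 1 else 0 := by
        intro j
        rw [← Equiv.sum_comp (Equiv.mulLeft (Equiv.swap (s t) j))]
        refine Finset.sum_congr rfl fun σ _ => if_congr ?_ rfl rfl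
        simp only [T, rename_eq_iff, Equiv.coe_mulLeft, rename_rename, inv_mul_cancel_left]
      rw [Finset.sum_comm, Finset.sum_congr rfl fun j _ => h2 j, Finset.sum_const,
        Finset.card_univ, Fintype.card_fin, nsmul_eq_mul, Finset.mul_sum]
      exact Finset.sum_congr rfl fun σ _ => by split_ifs <;> simp
    have h3 : ∀ σ, ω (rename σ u) + ∑ t, n t (rename σ u) * c t = 3 * c ⟨_, hren σ hu⟩ :=
      fun σ => (hcu ⟨_, hren σ hu⟩).symm
    simp only [symmetrize, hvu, Finset.sum_sub_distrib, h3]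
    rw [Finset.sum_comm]
    simp only [← Finset.mul_sum, h1]
    simp only [Finset.mul_sum]
    rw [Finset.sum_comm, ← Finset.sum_sub_distrib]
    refine Finset.sum_eq_zero fun σ _ => ?_
    rw [Finset.sum_eq_single ⟨_, hren σ hu⟩]
    · simp; ring
    · intro t _ ht
      rw [if_neg fun h => ht (Subtype.ext h), mul_zero]
    · simp
  have h0 : ∀ f : W.clone.Op 3, ¬ f.1.IsProjection → ¬ Bad f →
      ∀ σ ∈ Finset.univ, 0 ≤ v (rename σ f) := fun f hf hfb σ _ =>
    (hnn _ fun h => hf (isProjection_rename.1 h)).trans (hgood _ fun h => hfb (hren' σ h))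
  have hpos : 0 < symmetrize v f₀ := Finset.sum_pos' (h0 f₀ hf₀p (hconst hb₀))
    ⟨1, Finset.mem_univ _, hf₀.trans_le (hgood f₀ (hconst hb₀))⟩
  obtain ⟨ω', hω', hpr', a, ha, h⟩ := exists_balanced hv (fun f hf => by
    by_cases hfb : Bad f
    · exact (hbad f hfb).ge
    · exact Finset.sum_nonneg (h0 f hf hfb)) hpos
  refine ⟨ω', hω', hpr', ⟨f₀, by rw [h]; positivity⟩, fun f hf => ?_⟩
  obtain ⟨u, hu⟩ := htyped ω' hω' f hf
  rcases type_cases u with ⟨b, rfl⟩ | ⟨i, b, rfl⟩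
  · exact ⟨b, hu⟩
  · exfalso
    have hfp : ¬ f.1.IsProjection := fun h => by
      obtain ⟨i, rfl⟩ := isProjection_iff.1 h
      rw [hpr'] at hf
      linarith
    rw [h, hbad f ⟨hfp, i, b, hu⟩, mul_zero] at hf
    exact lt_irrefl _ hf

/-- The ternary case: all ternary weightings have typed support, and `ω` is balanced. -/
theorem ternary_cases [Nontrivial D] (hno : ∀ ω ∈ W.weightings 2, ¬ IsPositive ω)
    (htyped : ∀ ω ∈ W.weightings 3, ∀ f, 0 < ω f → ∃ u, f.1.HasType u)
    {ω : W.clone.Op 3 → ℚ} (hω : ω ∈ W.weightings 3) (hpr : ∀ i, ω (pr _ i) = -1)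
    (hsupp : ∃ f, 0 < ω f) :
    (∃ ω ∈ W.weightings 3, (supp ω).Nonempty ∧
      ((∀ f ∈ supp ω, f.1.IsMajority) ∨ (∀ f ∈ supp ω, f.1.IsMinority) ∨
       ((∀ f ∈ supp ω, f.1.IsMajority ∨ f.1.IsMinority) ∧
        suppWeight ω IsMajority = 2 ∧ suppWeight ω IsMinority = 1))) ∨
    (∃ ω ∈ W.weightings 3, (supp ω).Nonempty ∧ ∀ f ∈ supp ω, f.1.IsSemiprojection) := by
  classical
  have hnp : ∀ {ω : W.clone.Op 3 → ℚ}, (∀ i, ω (pr _ i) = -1) → ∀ {f : W.clone.Op 3}, 0 < ω f →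
      ¬ f.1.IsProjection := by
    intro ω hpr f hf h
    obtain ⟨i, rfl⟩ := isProjection_iff.1 h
    rw [hpr] at hf
    linarith
  have hmajproj : ∀ {f : W.clone.Op 3} {b : Bool}, f.1.HasType (fun _ => b) →
      ¬ f.1.IsProjection := by
    rintro f b hf h
    obtain ⟨i, rfl⟩ := isProjection_iff.1 h
    refine type_const_ne b i false (hf.unique ?_)
    simp only [Bool.bne_false]
    exact hasType_proj i
  by_cases hzero : ∀ ω ∈ W.weightings 2, ω = 0
  · obtain ⟨φ, hφ, hφω⟩ := exists_count hzero
    have hφpr : ∀ i, φ (pr _ i) = 1 := fun i => by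
      rw [hφ _ _ (hasType_proj i)]
      simp
    by_cases hc : ∃ f, 0 < ω f ∧ ∃ b, f.1.HasType fun _ => b
    · obtain ⟨f₀, hf₀, b₀, hb₀⟩ := hc
      obtain ⟨ω', hω', hpr', ⟨f₁, hf₁⟩, hty⟩ :=
        exists_weighting_of_const_type htyped hω hpr hf₀ hb₀
      left
      refine ⟨ω', hω', ⟨f₁, hf₁⟩, Or.inr (Or.inr ⟨fun f hf => ?_, ?_⟩)⟩
      · obtain ⟨b, hb⟩ := hty f hf
        cases b
        · exact Or.inl (hasType_false_iff.1 hb)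
        · exact Or.inr (hasType_true_iff.1 hb)
      let A : W.clone.Op 3 → ℚ := fun f => if f ∈ supp ω' ∧ f.1.IsMajority then ω' f else 0
      let B : W.clone.Op 3 → ℚ := fun f => if f ∈ supp ω' ∧ f.1.IsMinority then ω' f else 0
      have hA : suppWeight ω' IsMajority = ∑ f, A f := by rw [suppWeight, Finset.sum_filter]
      have hB : suppWeight ω' IsMinority = ∑ f, B f := by rw [suppWeight, Finset.sum_filter]
      -- `φ` is `0` on majority and `3` on minority operations. With `a` and `b` the totals of `A`
      -- and `B`, the two relations become `a + b = 3` and `2 * b = a`.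
      have hAB : ∀ f : W.clone.Op 3, (if f.1.IsProjection then 0 else ω' f) = A f + B f ∧
          (if f.1.IsProjection then 0 else ω' f * (φ f - 1)) = 2 * B f - A f := by
        intro f
        by_cases hf : 0 < ω' f
        · rw [if_neg (hnp hpr' hf), if_neg (hnp hpr' hf)]
          obtain ⟨b, hb⟩ := hty f hf
          have hφf := hφ _ _ hb
          have hfs : f ∈ supp ω' := hf
          cases b
          · have h1 : ¬ f.1.IsMinority := fun h => by
              simpa using congrFun (hb.unique (hasType_true_iff.2 h)) 0
            simp [A, B, hfs, h1, hasType_false_iff.1 hb, hφf]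
          · have h1 : ¬ f.1.IsMajority := fun h => by
              simpa using congrFun (hb.unique (hasType_false_iff.2 h)) 0
            simp [A, B, hfs, h1, hasType_true_iff.1 hb, hφf]
            ring
        · have hfs : f ∉ supp ω' := hf
          have hA0 : A f = 0 := if_neg fun h => hfs h.1
          have hB0 : B f = 0 := if_neg fun h => hfs h.1
          rw [hA0, hB0]
          by_cases hfp : f.1.IsProjection
          · simp [hfp]
          · have : ω' f = 0 := le_antisymm (le_of_not_gt hf)
              (le_of_not_gt fun h => hfp ((W.isWeighting _ ω' hω').1 f h))
            simp [this]
      have h1 := (W.isWeighting _ ω' hω').2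
      have h2 := hφω ω' hω'
      rw [sum_eq_sum_add_sum_pr, Finset.sum_congr rfl fun f _ => (hAB f).1,
        Finset.sum_add_distrib] at h1
      rw [sum_eq_sum_add_sum_pr, Finset.sum_congr rfl fun f _ => (hAB f).2,
        Finset.sum_sub_distrib, ← Finset.mul_sum] at h2
      simp only [hpr', hφpr, Finset.sum_const, Finset.card_univ, Fintype.card_fin] at h1 h2
      norm_num at h1 h2
      rw [hA, hB]
      constructor <;> linarith
    · push Not at hc
      right
      have hcase : ∀ f, 0 < ω f → ∃ i b, f.1.HasType (fun d => decide (d = i) != b) ∧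
          φ f = if b then 2 else 1 := by
        intro f hf
        obtain ⟨u, hu⟩ := htyped ω hω f hf
        rcases type_cases u with ⟨b, rfl⟩ | ⟨i, b, rfl⟩
        · exact absurd hu (hc f hf b)
        · refine ⟨i, b, hu, ?_⟩
          rw [hφ _ _ hu]
          clear hu
          fin_cases i <;> cases b <;> simp [Fin.sum_univ_three] <;> norm_num
      -- Only Pixley types contribute, with `φ f - 1 = 1`; as the sum is zero, none of them lies in
      -- the support.
      have hterm : ∀ f ∈ Finset.univ, 0 ≤ ω f * (φ f - 1) := by
        intro f _
        by_cases hf : 0 < ω f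
        · obtain ⟨i, b, -, h⟩ := hcase f hf
          refine mul_nonneg hf.le ?_
          rw [h]
          split_ifs <;> norm_num
        · by_cases hfp : f.1.IsProjection
          · obtain ⟨i, rfl⟩ := isProjection_iff.1 hfp
            rw [hφpr, sub_self, mul_zero]
          · have : ω f = 0 := le_antisymm (le_of_not_gt hf)
              (le_of_not_gt fun h => hfp ((W.isWeighting _ ω hω).1 f h))
            rw [this, zero_mul]
      refine ⟨ω, hω, hsupp, fun f hf => ?_⟩
      have h1 := (Finset.sum_eq_zero_iff_of_nonneg hterm).1 (hφω ω hω) f (Finset.mem_univ f)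
      obtain ⟨i, b, hty, h⟩ := hcase f hf
      cases b
      · exact HasType.isSemiprojection (i := i) (by simpa using hty) (hnp hpr hf)
      · rw [h] at h1
        norm_num at h1
        exact absurd h1 (ne_of_gt hf)
  · push Not at hzero
    obtain ⟨β, hβ, hβ0⟩ := hzero
    obtain ⟨f, hf⟩ := hsupp
    obtain ⟨u, hu⟩ := htyped ω hω f hf
    have hmaj : ∀ g : W.clone.Op 3, g.1.IsMajority → ∃ ω ∈ W.weightings 3, (supp ω).Nonempty ∧
        ∀ f ∈ supp ω, f.1.IsMajority := by
      intro g hg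
      obtain ⟨ω', hω', h⟩ :=
        exists_supp_eq_singleton hno hβ hβ0 (hmajproj (hasType_false_iff.2 hg))
      exact ⟨ω', hω', by simp [h], by simpa [h] using hg⟩
    obtain ⟨ω', hω', h⟩ := exists_supp_eq_singleton hno hβ hβ0 (hnp hpr hf)
    rcases type_cases u with ⟨b, rfl⟩ | ⟨i, b, rfl⟩
    · left
      cases b
      · exact ⟨ω', hω', by simp [h], Or.inl (by simpa [h] using hasType_false_iff.1 hu)⟩
      · exact ⟨ω', hω', by simp [h], Or.inr (Or.inl (by simpa [h] using hasType_true_iff.1 hu))⟩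
    · cases b
      · right
        refine ⟨ω', hω', by simp [h], ?_⟩
        rw [h]
        rintro _ rfl
        exact HasType.isSemiprojection (i := i) (by simpa using hu) (hnp hpr hf)
      · left
        obtain ⟨ω'', hω'', h1, h2⟩ := hmaj _ (HasType.majority_of_pixley hu)
        exact ⟨ω'', hω'', h1, Or.inl h2⟩

end WeightedClone

/-! ### The main theorem, by minimal arity. -/

theorem OperationClone.isIdempotent_of_ops_one {D : Type*} {C : OperationClone D}
    (h : C.ops 1 = {Operation.proj D (0 : Fin 1)}) {k : ℕ} (f : C.Op k) : f.1.IsIdempotent := by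
  intro x
  have := Set.mem_singleton_iff.1 (h.subset (comp f fun _ : Fin k => pr C (0 : Fin 1)).2)
  exact congrFun this fun _ => x

theorem mainTheorem1 {D : Type*} [Finite D] [Nontrivial D] (W : WeightedClone D)
    (hrigid : W.IsRigidCore)
    (hpos : ∃ k : ℕ, ∃ ω ∈ W.weightings k, OperationClone.IsPositive ω) :
    (∃ ω ∈ W.weightings 2, (OperationClone.supp ω).Nonempty ∧
      ∀ f ∈ OperationClone.supp ω, f.1.IsIdempotent ∧ ¬ f.1.IsProjection) ∨
    (∃ ω ∈ W.weightings 3, (OperationClone.supp ω).Nonempty ∧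
      ((∀ f ∈ OperationClone.supp ω, f.1.IsMajority) ∨
       (∀ f ∈ OperationClone.supp ω, f.1.IsMinority) ∨
       ((∀ f ∈ OperationClone.supp ω, f.1.IsMajority ∨ f.1.IsMinority) ∧
        OperationClone.suppWeight ω Operation.IsMajority = 2 ∧
        OperationClone.suppWeight ω Operation.IsMinority = 1))) ∨
    (∃ k : ℕ, 3 ≤ k ∧ ∃ ω ∈ W.weightings k, (OperationClone.supp ω).Nonempty ∧
      ∀ f ∈ OperationClone.supp ω, f.1.IsSemiprojection) := by
  classical
  obtain ⟨ω₀, hω₀, hp₀⟩ := Nat.find_spec hpos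
  have hmin : ∀ m < Nat.find hpos, ∀ ω ∈ W.weightings m, ¬ OperationClone.IsPositive ω :=
    fun m hm ω hω h => Nat.find_min hpos hm ⟨ω, hω, h⟩
  generalize Nat.find hpos = k at ω₀ hω₀ hp₀ hmin
  have hk : 2 ≤ k := by
    by_contra! hk
    obtain ⟨f, -, hf⟩ := hp₀
    obtain rfl | rfl : k = 0 ∨ k = 1 := by omega
    · simp [W.weightings_zero] at hω₀
    · refine hf ⟨0, Set.mem_singleton_iff.1 ((Set.Subset.antisymm_iff.1 hrigid).1 f.2)⟩
  obtain ⟨n, rfl⟩ : ∃ n, k = n + 1 := ⟨k - 1, by omega⟩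
  have : NeZero n := ⟨by omega⟩
  obtain ⟨ω, hω, hpr, f₀, hf₀⟩ := WeightedClone.exists_balanced_of_isPositive hω₀ hp₀
  have hnp : ∀ f, 0 < ω f → ¬ f.1.IsProjection := by
    intro f hf h
    obtain ⟨i, rfl⟩ := OperationClone.isProjection_iff.1 h
    rw [hpr] at hf
    linarith
  have hminor := fun ω hω f hf i j hij => WeightedClone.exists_minor_eq_proj
    (hmin n (Nat.lt_succ_self n)) (ω := ω) hω (f := f) hf (i := i) (j := j) hij
  -- The minimal arity is `n + 1`, so the cases are arity two, three, and at least four.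
  obtain rfl | rfl | hn : n = 1 ∨ n = 2 ∨ 3 ≤ n := by omega
  · exact Or.inl ⟨ω, hω, ⟨f₀, hf₀⟩, fun f hf =>
      ⟨OperationClone.isIdempotent_of_ops_one hrigid f, hnp f hf⟩⟩
  · rcases WeightedClone.ternary_cases (hmin 2 (by norm_num))
      (fun ω hω f hf => Operation.exists_hasType fun i j hij => hminor ω hω f hf i j hij)
      hω hpr ⟨f₀, hf₀⟩ with h | h
    · exact Or.inr (Or.inl h)
    · exact Or.inr (Or.inr ⟨3, le_rfl, h⟩)
  · refine Or.inr (Or.inr ⟨n + 1, by omega, ω, hω, ⟨f₀, hf₀⟩, fun f hf =>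
      ⟨by omega, hnp f hf, ?_⟩⟩)
    exact Operation.exists_forall_not_injective_eq (by omega) fun i j hij =>
      hminor ω hω f hf i j hij
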